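/- All graphs are finite, simple and undirected. For integers $t\ge 1$, $n\ge 1$ and a graph $G$ with vertex set $\{1,\dots,n\}$, the $t$-clique tensor $\mathcal A(G)=(a_{i_1\cdots i_t})$ of $G$ is the order $t$, dimension $n$ tensor with $a_{i_1\cdots i_t}=\frac1{(t-1)!}$ if $\{i_1,\dots,i_t\}$ is a clique of $G$ with exactly $t$ vertices, and $a_{i_1\cdots i_t}=0$ otherwise. A number $\lambda\in\mathbb C$ is an eigenvalue of $\mathcal A(G)$ if there is a nonzero $x\in\mathbb C^n$ with $$\sum_{i_2,\dots,i_t=1}^n a_{i i_2\cdots i_t}x_{i_2}\cdots x_{i_t}=\lambda x_i^{t-1}\qquad(i=1,\dots,n)$$ (with $x_i^0=1$ when $t=1$). The $t$-clique spectral radius $\mu_t(G)$ is the largest modulus of an eigenvalue of $\mathcal A(G)$, and $ex_{\mu_t}(n,H)$ is the largest value of $\mu_t(G)$ over all graphs $G$ on $n$ vertices that contain no (not necessarily induced) subgraph isomorphic to $H$. Theorem. Let $r\ge 1$ be an integer and let $H$ be a graph with chromatic number $\chi(H)=r+1$. Then, for every $n\ge1$, the maxima defining $\mu_r(G)$ (for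 every graph $G$ on $n$ vertices) and $ex_{\mu_r}(n,H)$ exist, and $$ex_{\mu_r}(n,H)=\left(\frac1{r^{r-1}}+o(1)\right)n^{r-1}\qquad(n\to\infty),$$ where $H$ and $r$ are fixed. -/

import Mathlib

open Filter Topology
open scoped Nat

noncomputable section

/-- A complex tensor of order `m` with indices in `V` (of dimension `n` when `V = Fin n`). -/
abbrev HypTensor (V : Type*) (m : ℕ) : Type _ := (Fin m → V) → ℂ

namespace HypTensor

variable {V : Type*} [Fintype V] {m : ℕ} [NeZero m]

open Classical in
/-- The vector `A x^{m-1}`: its component at `i` is the sum, over all index tuples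
`k = (i, k₂, …, k_m)` with first index `i`, of `a_k * x_{k₂} * ⋯ * x_{k_m}`. -/
def apply (A : HypTensor V m) (x : V → ℂ) (i : V) : ℂ :=
  ∑ k : Fin m → V with k 0 = i, A k * ∏ j : Fin m with j ≠ 0, x (k j)

/-- `l` is an eigenvalue of `A`: there is a nonzero complex vector `x` with
`A x^{m-1} = l x^{[m-1]}`. -/
def IsEigenvalue (A : HypTensor V m) (l : ℂ) : Prop :=
  ∃ x : V → ℂ, x ≠ 0 ∧ ∀ i, A.apply x i = l * x i ^ (m - 1)

/-- The set of moduli of the eigenvalues of `A`. -/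
def eigenvalueModuli (A : HypTensor V m) : Set ℝ :=
  {ρ | ∃ l : ℂ, A.IsEigenvalue l ∧ ρ = ‖l‖}

/-- The spectral radius of `A`: the largest modulus of an eigenvalue. -/
def spectralRadius (A : HypTensor V m) : ℝ := sSup A.eigenvalueModuli

end HypTensor

namespace SimpleGraph

open Classical in
/-- The `t`-clique tensor of `G`: the entry at `(i₁, …, i_t)` is `1 / (t - 1)!` if
`{i₁, …, i_t}` is a clique of `G` with exactly `t` vertices, and `0` otherwise. -/
def cliqueTensor {V : Type*} (G : SimpleGraph V) (t : ℕ) : HypTensor V t :=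
  fun k => if G.IsNClique t (Finset.univ.image k) then 1 / ((t - 1)! : ℂ) else 0

/-- The `t`-clique spectral radius of `G`. -/
def cliqueSpectralRadius {V : Type*} [Fintype V] (G : SimpleGraph V) (t : ℕ) [NeZero t] : ℝ :=
  (G.cliqueTensor t).spectralRadius

/-- The `t`-clique spectral radii of the `H`-free graphs on `n` vertices
(no subgraph, induced or not, is isomorphic to `H`). -/
def freeCliqueSpectralRadii {W : Type*} (H : SimpleGraph W) (t : ℕ) [NeZero t] (n : ℕ) : Set ℝ :=
  {ρ | ∃ G : SimpleGraph (Fin n), H.Free G ∧ ρ = G.cliqueSpectralRadius t}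

/-- The largest `t`-clique spectral radius of an `H`-free graph on `n` vertices. -/
def exCliqueSpectralRadius {W : Type*} (H : SimpleGraph W) (t : ℕ) [NeZero t] (n : ℕ) : ℝ :=
  sSup (H.freeCliqueSpectralRadii t n)

end SimpleGraph

end

/-! Let T_s be the total weight of ordered s-cliques under nonnegative vertex weights w
(`cliqueWeight`). Upper bound: the moduli of an eigenvector for λ, rescaled so that ∑ w^r =
n^{-(r-1)}, satisfy ∑ w ≤ 1 by the power mean inequality and |λ| n^{-(r-1)} ≤ T_r/(r-1)!
(`exists_weight_of_isEigenvalue`). Since H is (r+1)-colourable, an H-free graph has only o(n^{r+1})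
ordered (r+1)-cliques: a positive density would produce a large blow-up containing H
(`eventually_relCount_isCliqueTuple_le`). For r ≥ 2, Hölder turns this count into T_{r+1} = o(1)
(`cliqueWeight_pow_le`). The weighted Moon–Moser inequality then gives T_r ≤ r!/r^r + o(1)
(`exists_cliqueWeight_le`), and r!/(r^r (r-1)!) = 1/r^{r-1}.

Lower bound: a complete r-partite graph with parts of size q = ⌊n/r⌋, plus isolated vertices, is
r-colourable, hence H-free, and has eigenvalue q^{r-1}
(`isEigenvalue_map_completeEquipartiteGraph`).

The maxima exist because normalized eigenpairs form a nonempty compact set and there are finitely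
many graphs on n vertices. -/

namespace SimpleGraph

/-! ### Weighted clique counts and the Moon–Moser inequality. -/

/-- The entries of the tuple `k` are pairwise adjacent. -/
def IsCliqueTuple {V : Type*} (G : SimpleGraph V) {s : ℕ} (k : Fin s → V) : Prop :=
  Pairwise fun i j => G.Adj (k i) (k j)

lemma isCliqueTuple_insertNth {V : Type*} (G : SimpleGraph V) {s : ℕ} (p : Fin (s + 1)) (z : V)
    (k : Fin s → V) :
    G.IsCliqueTuple (p.insertNth z k : Fin (s + 1) → V) ↔
      (∀ j, G.Adj z (k j)) ∧ G.IsCliqueTuple k := by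
  constructor
  · intro h
    refine ⟨fun j => ?_, fun i j hij => ?_⟩
    · simpa using h (Fin.succAbove_ne p j).symm
    · simpa using h (i := p.succAbove i) (j := p.succAbove j) (by simpa using hij)
  · rintro ⟨h1, h2⟩ i j hij
    induction i using p.succAboveCases with
    | x =>
      induction j using p.succAboveCases with
      | x => exact absurd rfl hij
      | p j => simpa using h1 j
    | p i =>
      induction j using p.succAboveCases with
      | x => simpa using (h1 i).symm
      | p j => simpa using h2 (i := i) (j := j) (by rintro rfl; exact hij rfl)

lemma sum_tuple_insertNth {V M : Type*} [Fintype V] [AddCommMonoid M] {s : ℕ} (p : Fin (s + 1))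
    (f : (Fin (s + 1) → V) → M) :
    ∑ k, f k = ∑ k : Fin s → V, ∑ z, f (p.insertNth z k) := by
  classical
  rw [← (Fin.insertNthEquiv (fun _ => V) p).sum_comp, Fintype.sum_prod_type, Finset.sum_comm]
  rfl

open Classical in
/-- The product of the weights of the entries of a clique tuple, and `0` for other tuples. -/
noncomputable def tupleWeight {V : Type*} (G : SimpleGraph V) (w : V → ℝ) {s : ℕ}
    (k : Fin s → V) : ℝ :=
  if G.IsCliqueTuple k then ∏ j, w (k j) else 0

open Classical in
/-- The total weight of the common neighbours of the entries of `k`. -/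
noncomputable def linkWeight {V : Type*} [Fintype V] (G : SimpleGraph V) (w : V → ℝ) {s : ℕ}
    (k : Fin s → V) : ℝ :=
  ∑ z, if ∀ j, G.Adj z (k j) then w z else 0

/-- The weighted number of ordered `s`-cliques. -/
noncomputable def cliqueWeight {V : Type*} [Fintype V] (G : SimpleGraph V) (w : V → ℝ)
    (s : ℕ) : ℝ :=
  ∑ k : Fin s → V, G.tupleWeight w k

section MoonMoser

variable {V : Type*} {G : SimpleGraph V} {w : V → ℝ}

lemma tupleWeight_nonneg (hw : ∀ v, 0 ≤ w v) {s : ℕ} (k : Fin s → V) :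
    0 ≤ G.tupleWeight w k := by
  unfold tupleWeight
  split_ifs
  · exact Finset.prod_nonneg fun j _ => hw _
  · exact le_rfl

lemma tupleWeight_insertNth {s : ℕ} (p : Fin (s + 1)) (z : V) (k : Fin s → V)
    [Decidable (∀ j, G.Adj z (k j))] :
    G.tupleWeight w (p.insertNth z k : Fin (s + 1) → V) =
      G.tupleWeight w k * if ∀ j, G.Adj z (k j) then w z else 0 := by
  unfold tupleWeight
  rw [isCliqueTuple_insertNth, Fin.prod_univ_succAbove _ p]
  by_cases h1 : ∀ j, G.Adj z (k j) <;> by_cases h2 : G.IsCliqueTuple k <;>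
    simp [h1, h2, mul_comm]

/-- A vertex outside the common neighbourhood of a clique is adjacent to all but one of its
vertices for at most one choice of that vertex. -/
lemma sum_ite_adj_le (hw : ∀ v, 0 ≤ w v) {s : ℕ} (k : Fin (s + 1) → V) (z : V)
    [Decidable (∀ j, G.Adj z (k j))]
    [∀ i : Fin (s + 1), Decidable (∀ j, G.Adj z (k (i.succAbove j)))] :
    ∑ i : Fin (s + 1), (if ∀ j, G.Adj z (k (i.succAbove j)) then w z else 0) ≤
      w z + s * if ∀ j, G.Adj z (k j) then w z else 0 := by
  by_cases h : ∀ j, G.Adj z (k j)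
  · simp [h]
    linarith
  · rw [if_neg h]
    push Not at h
    obtain ⟨j, hj⟩ := h
    rw [Finset.sum_eq_single_of_mem j (Finset.mem_univ _)]
    · split_ifs <;> simp [hw z]
    · intro i _ hij
      rw [if_neg]
      intro h
      obtain ⟨l, hl⟩ := Fin.exists_succAbove_eq hij.symm
      exact hj (hl ▸ h l)

variable [Fintype V]

lemma linkWeight_le (hw : ∀ v, 0 ≤ w v) {s : ℕ} (k : Fin s → V) :
    G.linkWeight w k ≤ ∑ v, w v :=
  Finset.sum_le_sum fun z _ => by split_ifs; exacts [le_rfl, hw z]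

lemma cliqueWeight_nonneg (hw : ∀ v, 0 ≤ w v) (s : ℕ) : 0 ≤ G.cliqueWeight w s :=
  Finset.sum_nonneg fun k _ => tupleWeight_nonneg hw k

lemma cliqueWeight_zero : G.cliqueWeight w 0 = 1 := by
  unfold cliqueWeight
  have : G.IsCliqueTuple (default : Fin 0 → V) := fun i => i.elim0
  rw [Fintype.sum_unique]
  simp [tupleWeight, this]

lemma cliqueWeight_succ (s : ℕ) :
    G.cliqueWeight w (s + 1) = ∑ k : Fin s → V, G.tupleWeight w k * G.linkWeight w k := by
  classical
  unfold cliqueWeight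
  rw [sum_tuple_insertNth 0]
  simp_rw [tupleWeight_insertNth, ← Finset.mul_sum]
  unfold linkWeight
  congr! 5

lemma cliqueWeight_succ_le (hw : ∀ v, 0 ≤ w v) (h1 : ∑ v, w v ≤ 1) (s : ℕ) :
    G.cliqueWeight w (s + 1) ≤ G.cliqueWeight w s := by
  rw [cliqueWeight_succ]
  exact Finset.sum_le_sum fun k _ =>
    mul_le_of_le_one_right (tupleWeight_nonneg hw k) ((linkWeight_le hw k).trans h1)

/-- Cauchy–Schwarz for the link weight, with the tuple weights as measure. -/
lemma cliqueWeight_sq_le (hw : ∀ v, 0 ≤ w v) (s : ℕ) :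
    G.cliqueWeight w (s + 1) ^ 2 ≤
      G.cliqueWeight w s * ∑ k : Fin s → V, G.tupleWeight w k * G.linkWeight w k ^ 2 := by
  rw [cliqueWeight_succ]
  refine Finset.sum_sq_le_sum_mul_sum_of_sq_le_mul _ (fun k _ => tupleWeight_nonneg hw k)
    (fun k _ => mul_nonneg (tupleWeight_nonneg hw k) (sq_nonneg _)) fun k _ => le_of_eq (by ring)

/-- Double counting of pairs of an (s+1)-clique and a vertex z adjacent to all its entries except
possibly the i-th. For fixed i, the i-th entry and z range independently over the common
neighbourhood of the other s entries, which gives the squared link weight; for a fixed clique,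
`sum_ite_adj_le` bounds the sum over i. -/
lemma moon_moser (hw : ∀ v, 0 ≤ w v) (s : ℕ) :
    (s + 1) * ∑ k : Fin s → V, G.tupleWeight w k * G.linkWeight w k ^ 2 ≤
      (∑ v, w v) * G.cliqueWeight w (s + 1) + s * G.cliqueWeight w (s + 2) := by
  classical
  have key : ∑ k : Fin (s + 1) → V, G.tupleWeight w k *
      ∑ z, ∑ i : Fin (s + 1), (if ∀ j, G.Adj z (k (i.succAbove j)) then w z else 0) =
      (s + 1) * ∑ k : Fin s → V, G.tupleWeight w k * G.linkWeight w k ^ 2 := by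
    have h : ∀ i : Fin (s + 1), ∑ k : Fin (s + 1) → V, G.tupleWeight w k *
        ∑ z, (if ∀ j, G.Adj z (k (i.succAbove j)) then w z else 0) =
        ∑ k : Fin s → V, G.tupleWeight w k * G.linkWeight w k ^ 2 := by
      intro i
      rw [sum_tuple_insertNth i]
      simp_rw [tupleWeight_insertNth, Fin.insertNth_apply_succAbove, ← Finset.sum_mul,
        ← Finset.mul_sum]
      refine Finset.sum_congr rfl fun k _ => ?_
      rw [sq, mul_assoc]
      unfold linkWeight
      congr! 5
    simp_rw [Finset.sum_comm (s := (Finset.univ : Finset V)),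
      Finset.mul_sum (s := (Finset.univ : Finset (Fin (s + 1))))]
    rw [Finset.sum_comm]
    simp [h]
  rw [← key, cliqueWeight_succ (s + 1)]
  unfold cliqueWeight
  rw [Finset.mul_sum, Finset.mul_sum, ← Finset.sum_add_distrib]
  refine Finset.sum_le_sum fun k _ => ?_
  calc _ ≤ G.tupleWeight w k * ∑ z, (w z + s * if ∀ j, G.Adj z (k j) then w z else 0) :=
        mul_le_mul_of_nonneg_left (Finset.sum_le_sum fun z _ => sum_ite_adj_le hw k z)
          (tupleWeight_nonneg hw k)
    _ = _ := by
        rw [Finset.sum_add_distrib, ← Finset.mul_sum]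
        unfold linkWeight
        have : (∑ z, if ∀ j, G.Adj z (k j) then w z else 0) =
          ∑ z, @ite _ (∀ j, G.Adj z (k j)) (Classical.propDecidable _) (w z) 0 := by congr!
        rw [this]
        ring

/-- The Moon–Moser inequality for weighted graphs. -/
lemma succ_mul_cliqueWeight_sq_le (hw : ∀ v, 0 ≤ w v) (h1 : ∑ v, w v ≤ 1) (s : ℕ) :
    (s + 1) * G.cliqueWeight w (s + 1) ^ 2 ≤
      G.cliqueWeight w s * (G.cliqueWeight w (s + 1) + s * G.cliqueWeight w (s + 2)) := by
  have hs := cliqueWeight_nonneg (G := G) hw s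
  calc _ ≤ (s + 1) * (G.cliqueWeight w s * ∑ k : Fin s → V,
            G.tupleWeight w k * G.linkWeight w k ^ 2) := by
        gcongr
        exact cliqueWeight_sq_le hw s
    _ = G.cliqueWeight w s * ((s + 1) * ∑ k : Fin s → V,
            G.tupleWeight w k * G.linkWeight w k ^ 2) := by ring
    _ ≤ G.cliqueWeight w s * ((∑ v, w v) * G.cliqueWeight w (s + 1) +
            s * G.cliqueWeight w (s + 2)) := by
        gcongr
        exact moon_moser hw s
    _ ≤ _ := by
        gcongr
        exact mul_le_of_le_one_left (cliqueWeight_nonneg hw _) h1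

lemma cliqueWeight_pos_of_le (hw : ∀ v, 0 ≤ w v) (h1 : ∑ v, w v ≤ 1) {r s : ℕ} (hsr : s ≤ r)
    (hr : 0 < G.cliqueWeight w r) : 0 < G.cliqueWeight w s :=
  hr.trans_le (antitone_nat_of_succ_le (fun n => cliqueWeight_succ_le hw h1 n) hsr)

/-- Downward induction from s = r: a bound on T_{s+2}/T_{s+1} inserted into Moon–Moser gives one on
T_{s+1}/T_s. At η = 0 these are the ratios (r-s)/r of the balanced complete r-partite graph. -/
lemma cliqueWeight_succ_le_mul (hw : ∀ v, 0 ≤ w v) (h1 : ∑ v, w v ≤ 1) {r : ℕ} {η : ℝ}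
    (hη : 0 ≤ η) (hr : 0 < G.cliqueWeight w r)
    (hη' : G.cliqueWeight w (r + 1) ≤ η * G.cliqueWeight w r) (d : ℕ) :
    ∀ s, s + d = r →
      G.cliqueWeight w (s + 1) ≤ (d / r + η) * G.cliqueWeight w s := by
  induction d with
  | zero => rintro s rfl; simpa using hη'
  | succ d ih =>
    intro s hs
    have hr0 : (r : ℝ) = s + d + 1 := by rw [← hs]; push_cast; ring
    have hpos : (0 : ℝ) < r := by rw [hr0]; positivity
    have ih := ih (s + 1) (by omega)
    have hp := cliqueWeight_pos_of_le hw h1 (s := s + 1) (by omega) hr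
    have hs0 := cliqueWeight_nonneg (G := G) hw s
    have hm := succ_mul_cliqueWeight_sq_le (G := G) hw h1 s
    have h2 : (s + 1) * G.cliqueWeight w (s + 1) ^ 2 ≤
        G.cliqueWeight w s * (G.cliqueWeight w (s + 1) +
          s * ((d / r + η) * G.cliqueWeight w (s + 1))) := hm.trans (by gcongr)
    have h3 : (s + 1) * G.cliqueWeight w (s + 1) ≤
        (1 + s * (d / r + η)) * G.cliqueWeight w s :=
      le_of_mul_le_mul_right (by linarith) hp
    -- Since r = s + d + 1, one has r + sd = (s+1)(d+1), so the main terms agree exactly; only the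
    -- η-terms lose.
    have h4 : (1 + s * (d / r + η) : ℝ) ≤ (s + 1) * (((d + 1 : ℕ) : ℝ) / r + η) := by
      have : (1 : ℝ) + s * (d / r) = (s + 1) * (((d + 1 : ℕ) : ℝ) / r) := by
        field_simp
        rw [hr0]; push_cast; ring
      nlinarith
    have h5 := h3.trans (mul_le_mul_of_nonneg_right h4 hs0)
    rw [mul_assoc] at h5
    exact le_of_mul_le_mul_left h5 (by positivity)

lemma cliqueWeight_le_prod (hw : ∀ v, 0 ≤ w v) (h1 : ∑ v, w v ≤ 1) {r : ℕ} {η : ℝ}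
    (hη : 0 ≤ η) (hr : 0 < G.cliqueWeight w r)
    (hη' : G.cliqueWeight w (r + 1) ≤ η * G.cliqueWeight w r) :
    G.cliqueWeight w r ≤ ∏ s ∈ Finset.range r, (((r - s : ℕ) : ℝ) / r + η) := by
  suffices h : ∀ m ≤ r, G.cliqueWeight w m ≤ ∏ s ∈ Finset.range m, (((r - s : ℕ) : ℝ) / r + η) from
    h r le_rfl
  intro m
  induction m with
  | zero => simp [cliqueWeight_zero]
  | succ m ih =>
    intro hm
    rw [Finset.prod_range_succ, mul_comm]
    exact (cliqueWeight_succ_le_mul hw h1 hη hr hη' (r - m) m (by omega)).trans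
      (mul_le_mul_of_nonneg_left (ih (by omega)) (by positivity))

lemma prod_range_sub_div (r : ℕ) :
    ∏ s ∈ Finset.range r, (((r - s : ℕ) : ℝ) / r) = r ! / (r : ℝ) ^ r := by
  rw [Finset.prod_div_distrib, Finset.prod_const, Finset.card_range, ← Nat.descFactorial_self,
    Nat.descFactorial_eq_prod_range]
  push_cast
  rfl

end MoonMoser

/-- Few weighted `(r+1)`-cliques force the weighted number of `r`-cliques to be at most that of a
balanced complete `r`-partite graph, up to an error. -/
lemma exists_cliqueWeight_le (r : ℕ) {ε : ℝ} (hε : 0 < ε) :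
    ∃ η > 0, ∀ {V : Type*} [Fintype V] (G : SimpleGraph V) (w : V → ℝ), (∀ v, 0 ≤ w v) →
      ∑ v, w v ≤ 1 → G.cliqueWeight w (r + 1) ≤ η →
      G.cliqueWeight w r ≤ r ! / (r : ℝ) ^ r + ε := by
  have hc : Tendsto (fun η : ℝ => ∏ s ∈ Finset.range r, (((r - s : ℕ) : ℝ) / r + η)) (𝓝[>] 0)
      (𝓝 (r ! / (r : ℝ) ^ r)) := by
    rw [← prod_range_sub_div]
    have : Continuous fun η : ℝ => ∏ s ∈ Finset.range r, (((r - s : ℕ) : ℝ) / r + η) := by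
      fun_prop
    simpa using (this.tendsto 0).mono_left nhdsWithin_le_nhds
  obtain ⟨η, hη, hη0⟩ :=
    ((hc.eventually (gt_mem_nhds (lt_add_of_pos_right _ hε))).and self_mem_nhdsWithin).exists
  have hη0 : 0 < η := hη0
  -- If the conclusion fails then T_r ≥ ε, so T_{r+1} ≤ ηε ≤ ηT_r, which is the relative bound
  -- needed.
  refine ⟨η * ε, by positivity, fun {V} _ G w hw h1 h => ?_⟩
  by_contra! hlt
  have h0 : (0 : ℝ) ≤ r ! / (r : ℝ) ^ r := by positivity
  have hr : ε ≤ G.cliqueWeight w r := by linarith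
  have := cliqueWeight_le_prod hw h1 hη0.le (hε.trans_le hr)
    (h.trans (mul_le_mul_of_nonneg_left hr hη0.le))
  linarith

end SimpleGraph

/-! ### Supersaturation: dense relations contain many blow-ups. -/

lemma pow_sum_div_card_mul_card_le_sum_pow {ι : Type*} [Fintype ι] [Nonempty ι] {f : ι → ℝ}
    (hf : ∀ i, 0 ≤ f i) (m : ℕ) :
    ((∑ i, f i) / Fintype.card ι) ^ m * Fintype.card ι ≤ ∑ i, f i ^ m := by
  have hc : (0 : ℝ) < Fintype.card ι := by exact_mod_cast Fintype.card_pos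
  have h := Real.pow_arith_mean_le_arith_mean_pow (Finset.univ : Finset ι)
    (fun _ => (Fintype.card ι : ℝ)⁻¹) f (fun _ _ => by positivity)
    (by simp) (fun i _ => hf i) m
  rw [← Finset.mul_sum, ← Finset.mul_sum, inv_mul_eq_div, inv_mul_eq_div] at h
  rwa [le_div_iff₀ hc] at h

/-- The number of tuples satisfying a `k`-ary relation. -/
noncomputable def relCount {V : Type*} [Fintype V] {k : ℕ} (S : (Fin k → V) → Prop) : ℝ :=
  ∑ b, open Classical in if S b then 1 else 0

/-- All the transversals of the family `Φ` satisfy the relation `S`. -/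
def IsBlowup {V : Type*} {k : ℕ} (m : ℕ) (S : (Fin k → V) → Prop) (Φ : Fin k → Fin m → V) : Prop :=
  ∀ c : Fin k → Fin m, S fun i => Φ i (c i)

/-- The number of `m`-fold blow-ups of a tuple contained in the relation `S`. -/
noncomputable def blowupCount {V : Type*} [Fintype V] {k : ℕ} (m : ℕ)
    (S : (Fin k → V) → Prop) : ℝ :=
  ∑ Φ, open Classical in if IsBlowup m S Φ then 1 else 0

lemma isBlowup_cons {k m : ℕ} (S : (Fin (k + 1) → V) → Prop) (a : Fin m → V)
    (Φ : Fin k → Fin m → V) :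
    IsBlowup m S (Fin.cons a Φ : Fin (k + 1) → Fin m → V) ↔
      IsBlowup m (fun b => ∀ i, S (Fin.cons (a i) b)) Φ := by
  have h : ∀ (i : Fin m) (c : Fin k → Fin m),
      (fun j => (Fin.cons a Φ : Fin (k + 1) → Fin m → V) j
        ((Fin.cons i c : Fin (k + 1) → Fin m) j)) = Fin.cons (a i) fun j => Φ j (c j) := by
    intro i c
    funext j
    refine Fin.cases ?_ (fun j => ?_) j <;> simp
  constructor
  · intro H c i
    rw [← h]
    exact H _
  · intro H c
    have := H (Fin.tail c) (c 0)
    rwa [← h, Fin.cons_self_tail] at this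

section Blowup

variable {V : Type*} [Fintype V]

lemma relCount_nonneg {k : ℕ} (S : (Fin k → V) → Prop) : 0 ≤ relCount S :=
  Finset.sum_nonneg fun b _ => by split_ifs <;> norm_num

lemma sum_tuple_cons {α M : Type*} [Fintype α] [AddCommMonoid M] {k : ℕ}
    (f : (Fin (k + 1) → α) → M) :
    ∑ Φ, f Φ = ∑ a, ∑ Φ : Fin k → α, f (Fin.cons a Φ) := by
  rw [← (Fin.consEquiv fun _ => α).sum_comp, Fintype.sum_prod_type]
  rfl

lemma blowupCount_succ {k m : ℕ} (S : (Fin (k + 1) → V) → Prop) :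
    blowupCount m S = ∑ a : Fin m → V, blowupCount m fun b => ∀ i, S (Fin.cons (a i) b) := by
  classical
  unfold blowupCount
  rw [sum_tuple_cons]
  refine Finset.sum_congr rfl fun a _ => Finset.sum_congr rfl fun Φ _ => ?_
  exact if_congr (isBlowup_cons S a Φ) rfl rfl

/-- Both sides count pairs of a tuple b and m of its extensions: the right side expands the m-th
power of the degree of b. -/
lemma sum_relCount_forall {k m : ℕ} (S : (Fin (k + 1) → V) → Prop) :
    ∑ a : Fin m → V, relCount (fun b => ∀ i, S (Fin.cons (a i) b)) =
      ∑ b : Fin k → V, (∑ v, open Classical in if S (Fin.cons v b) then (1 : ℝ) else 0) ^ m := by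
  classical
  unfold relCount
  rw [Finset.sum_comm]
  refine Finset.sum_congr rfl fun b _ => ?_
  rw [Fintype.sum_pow]
  refine Finset.sum_congr rfl fun a _ => ?_
  rw [Finset.prod_ite_zero]
  simp

lemma relCount_succ {k : ℕ} (S : (Fin (k + 1) → V) → Prop) :
    relCount S =
      ∑ b : Fin k → V, ∑ v, open Classical in if S (Fin.cons v b) then (1 : ℝ) else 0 := by
  unfold relCount
  rw [sum_tuple_cons, Finset.sum_comm]

/-- A relation of density `d` contains at least the proportion `d ^ m ^ k` of all `m`-fold
blow-ups. -/
lemma density_pow_le_blowupCount [Nonempty V] (m : ℕ) {k : ℕ} (S : (Fin k → V) → Prop) :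
    (relCount S / Fintype.card V ^ k) ^ m ^ k * Fintype.card V ^ (m * k) ≤ blowupCount m S := by
  have hn : (0 : ℝ) < Fintype.card V := by exact_mod_cast Fintype.card_pos
  set n : ℝ := (Fintype.card V : ℝ)
  induction k with
  | zero =>
    classical
    apply le_of_eq
    unfold relCount blowupCount
    rw [Fintype.sum_unique, Fintype.sum_unique]
    have : IsBlowup m S default ↔ S default := by
      constructor
      · intro h
        convert h default
      · intro h c
        convert h
    simp only [pow_zero, mul_zero, div_one, mul_one, pow_one]
    exact (if_congr this rfl rfl).symm
  | succ k ih =>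
    -- Convexity is used twice: here for the degrees of the k-tuples, giving a large average density
    -- of the common links of m vertices; in `hjen` for those densities with exponent `m ^ k`, to
    -- average the induction hypothesis.
    have hdeg := pow_sum_div_card_mul_card_le_sum_pow (ι := Fin k → V)
      (f := fun b => ∑ v, open Classical in if S (Fin.cons v b) then (1 : ℝ) else 0)
      (fun b => Finset.sum_nonneg fun v _ => by split_ifs <;> norm_num) m
    rw [← sum_relCount_forall, ← relCount_succ] at hdeg
    have hjen := pow_sum_div_card_mul_card_le_sum_pow (ι := Fin m → V)
      (f := fun a => relCount (fun b => ∀ i, S (Fin.cons (a i) b)) / n ^ k)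
      (fun a => div_nonneg (relCount_nonneg _) (by positivity)) (m ^ k)
    rw [← Finset.sum_div] at hjen
    simp only [Fintype.card_pi, Finset.prod_const, Finset.card_univ, Fintype.card_fin,
      Nat.cast_pow] at hdeg hjen
    change _ ^ m * n ^ k ≤ _ at hdeg
    change (_ / n ^ m) ^ _ * n ^ m ≤ _ at hjen
    have hS := relCount_nonneg S
    rw [blowupCount_succ]
    calc (relCount S / n ^ (k + 1)) ^ m ^ (k + 1) * n ^ (m * (k + 1))
        = (((relCount S / n ^ k) ^ m * n ^ k) / n ^ k / n ^ m) ^ m ^ k * n ^ m * n ^ (m * k) := by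
          rw [mul_div_cancel_right₀ _ (by positivity), ← div_pow, div_div, ← pow_succ, ← pow_mul,
            mul_comm m (m ^ k), ← pow_succ, mul_assoc, ← pow_add, mul_add, mul_one, add_comm m]
      _ ≤ (∑ a : Fin m → V, (relCount (fun b => ∀ i, S (Fin.cons (a i) b)) / n ^ k) ^ m ^ k)
            * n ^ (m * k) := by
          refine mul_le_mul_of_nonneg_right (le_trans ?_ hjen) (by positivity)
          gcongr
      _ ≤ _ := by
          rw [Finset.sum_mul]
          exact Finset.sum_le_sum fun a _ => ih _

end Blowup

/-- Bernoulli's inequality; it shows that a proportion at most K²/n of the K-tuples has a repeated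
entry. -/
lemma pow_mul_one_sub_le_descFactorial {n K : ℕ} (hn : 1 ≤ n) (hK : K ≤ n) :
    (n : ℝ) ^ K * (1 - K ^ 2 / n) ≤ n.descFactorial K := by
  have hn' : (0 : ℝ) < n := by exact_mod_cast hn
  have hK' : (K : ℝ) ≤ n := by exact_mod_cast hK
  have h1 : ((n + 1 - K : ℕ) : ℝ) ^ K ≤ n.descFactorial K := by
    exact_mod_cast n.pow_sub_le_descFactorial K
  have h2 := one_add_mul_le_pow (a := -(K / n : ℝ))
    (by have : (K / n : ℝ) ≤ 1 := (div_le_one hn').2 hK'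
        linarith) K
  have h3 : (n : ℝ) - K ≤ ((n + 1 - K : ℕ) : ℝ) := by
    rw [Nat.cast_sub (by omega)]
    push_cast
    linarith
  calc (n : ℝ) ^ K * (1 - K ^ 2 / n) = n ^ K * (1 + K * -(K / n)) := by ring
    _ ≤ n ^ K * (1 + -(K / n)) ^ K := by gcongr
    _ = (n - K) ^ K := by
      rw [← mul_pow]
      congr 1
      field_simp
      ring
    _ ≤ ((n + 1 - K : ℕ) : ℝ) ^ K := by
      gcongr
    _ ≤ _ := h1

namespace SimpleGraph

/-- A vertex v goes to place e v of the row of its colour. Adjacent vertices lie in different rows,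
so some transversal contains both images. -/
lemma isContained_of_isBlowup {W V : Type*} {H : SimpleGraph W} {G : SimpleGraph V} {k m : ℕ}
    (C : H.Coloring (Fin k)) (e : W ↪ Fin m) {Φ : Fin k → Fin m → V}
    (hΦ : IsBlowup m G.IsCliqueTuple Φ) (hinj : Function.Injective (Function.uncurry Φ)) :
    H ⊑ G := by
  refine ⟨⟨⟨fun v => Φ (C v) (e v), fun {v w} h => ?_⟩, fun v w h => ?_⟩⟩
  · classical
    have hne := C.valid h
    have := hΦ (Function.update (fun _ => e w) (C v) (e v)) hne
    simpa [Function.update_of_ne hne.symm] using this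
  · have := @hinj (C v, e v) (C w, e w) h
    exact e.injective (Prod.mk.inj this).2

/-- In an H-free graph no clique blow-up is injective, so blow-ups and injective families are
disjoint sets of arrays. -/
lemma blowupCount_le_of_free {W V : Type*} [Fintype W] [Fintype V] {H : SimpleGraph W}
    {G : SimpleGraph V} {k : ℕ} (C : H.Coloring (Fin k)) (hfree : H.Free G) :
    blowupCount (Fintype.card W) (G.IsCliqueTuple (s := k)) +
      (Fintype.card V).descFactorial (Fintype.card W * k) ≤
      (Fintype.card V : ℝ) ^ (Fintype.card W * k) := by
  classical
  set m := Fintype.card W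
  have hinj : (Fintype.card V).descFactorial (m * k) =
      (Finset.univ.filter fun Φ : Fin k → Fin m → V =>
        Function.Injective (Function.uncurry Φ)).card := by
    have := Fintype.card_embedding_eq (α := Fin k × Fin m) (β := V)
    rw [Fintype.card_prod, Fintype.card_fin, Fintype.card_fin, mul_comm] at this
    rw [← this, ← Fintype.card_subtype]
    refine Fintype.card_congr ⟨fun f => ⟨Function.curry f, by simp [f.injective]⟩,
      fun Φ => ⟨Function.uncurry Φ.1, Φ.2⟩, fun f => ?_, fun Φ => ?_⟩
    · ext; rfl
    · ext; rfl
  unfold blowupCount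
  rw [Finset.sum_boole, hinj]
  norm_cast
  have hd : Disjoint (Finset.univ.filter fun Φ : Fin k → Fin m → V =>
      IsBlowup m (G.IsCliqueTuple (s := k)) Φ)
      (Finset.univ.filter fun Φ : Fin k → Fin m → V =>
        Function.Injective (Function.uncurry Φ)) := by
    rw [Finset.disjoint_left]
    intro Φ h1 h2
    simp only [Finset.mem_filter, Finset.mem_univ, true_and] at h1 h2
    exact hfree (isContained_of_isBlowup C (Fintype.equivFin W).toEmbedding h1 h2)
  have hcard : Fintype.card (Fin k → Fin m → V) = Fintype.card V ^ (m * k) := by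
    simp [pow_mul]
  rw [← hcard, ← Finset.card_union_of_disjoint (by convert hd)]
  exact Finset.card_le_univ _

/-- Graphs without a fixed `k`-colorable subgraph have a vanishing density of `k`-cliques. -/
lemma eventually_relCount_isCliqueTuple_le {W : Type*} [Finite W] {H : SimpleGraph W} {k : ℕ}
    (C : H.Coloring (Fin k)) {δ : ℝ} (hδ : 0 < δ) :
    ∀ᶠ n : ℕ in atTop, ∀ G : SimpleGraph (Fin n), H.Free G →
      relCount (G.IsCliqueTuple (s := k)) ≤ δ * n ^ k := by
  have := Fintype.ofFinite W
  set m := Fintype.card W with hm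
  have hlim : Tendsto (fun n : ℕ => ((m * k : ℕ) : ℝ) ^ 2 / n) atTop (𝓝 0) :=
    tendsto_const_div_atTop_nhds_zero_nat _
  -- For such n, the proportion of non-injective arrays is below δ^(m^k), the proportion of blow-ups
  -- forced by density δ.
  filter_upwards [hlim.eventually (gt_mem_nhds (pow_pos hδ (m ^ k))), eventually_ge_atTop 1,
    eventually_ge_atTop (m * k)] with n hn h1 hmk G hG
  have : Nonempty (Fin n) := ⟨⟨0, h1⟩⟩
  have hn0 : (0 : ℝ) < n := by exact_mod_cast h1
  have hden := density_pow_le_blowupCount (V := Fin n) m (G.IsCliqueTuple (s := k))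
  have hle := blowupCount_le_of_free C hG
  have hdesc := pow_mul_one_sub_le_descFactorial h1 hmk
  rw [Fintype.card_fin] at hden hle
  rw [← hm] at hle
  by_contra! hlt
  have h2 : δ < relCount (G.IsCliqueTuple (s := k)) / n ^ k := by
    rwa [lt_div_iff₀ (by positivity)]
  have h3 : δ ^ m ^ k ≤ (relCount (G.IsCliqueTuple (s := k)) / n ^ k) ^ m ^ k :=
    pow_le_pow_left₀ hδ.le h2.le _
  have hp : (0 : ℝ) < (n : ℝ) ^ (m * k) := by positivity
  have h4 := mul_lt_mul_of_pos_right (hn.trans_le h3) hp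
  linarith

/-! ### Upper bound for eigenvalues. -/

lemma isNClique_image_iff {V : Type*} [DecidableEq V] (G : SimpleGraph V) {r : ℕ}
    (k : Fin r → V) : G.IsNClique r (Finset.univ.image k) ↔ G.IsCliqueTuple k := by
  constructor
  · intro h i j hij
    have hinj : Function.Injective k := by
      have := Finset.card_image_iff.1 (h.card_eq.trans (by simp))
      simpa [Set.injOn_univ] using this
    exact h.isClique (by simp) (by simp) (hinj.ne hij)
  · intro h
    have hinj : Function.Injective k := fun i j hij => by
      by_contra hne
      exact (h hne).ne hij
    refine ⟨?_, by rw [Finset.card_image_of_injective _ hinj]; simp⟩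
    intro a ha b hb hab
    simp only [Finset.coe_image, Finset.coe_univ, Set.image_univ, Set.mem_range] at ha hb
    obtain ⟨i, rfl⟩ := ha
    obtain ⟨j, rfl⟩ := hb
    exact h fun hij => hab (congrArg k hij)

open Classical in
lemma cliqueTensor_apply {V : Type*} (G : SimpleGraph V) {r : ℕ} (k : Fin r → V) :
    G.cliqueTensor r k = if G.IsCliqueTuple k then 1 / ((r - 1)! : ℂ) else 0 := by
  unfold cliqueTensor
  exact if_congr (isNClique_image_iff G k) rfl rfl

lemma norm_cliqueTensor_mul_prod {V : Type*} (G : SimpleGraph V) {r : ℕ} (y : V → ℝ)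
    (k : Fin r → V) :
    ‖G.cliqueTensor r k‖ * ∏ j, y (k j) = G.tupleWeight y k / (r - 1)! := by
  rw [cliqueTensor_apply, tupleWeight]
  split_ifs
  · simp; ring
  · simp

/-- Multiply the i-th eigenvalue equation by x_i, take moduli, and sum over i. -/
lemma norm_eigenvalue_mul_sum_le {V : Type*} [Fintype V] (G : SimpleGraph V) {r : ℕ} [NeZero r]
    {l : ℂ} {x : V → ℂ} (hx : ∀ i, (G.cliqueTensor r).apply x i = l * x i ^ (r - 1)) :
    ‖l‖ * ∑ i, ‖x i‖ ^ r ≤ G.cliqueWeight (fun i => ‖x i‖) r / (r - 1)! := by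
  classical
  unfold cliqueWeight
  rw [Finset.mul_sum, Finset.sum_div,
    ← Finset.sum_fiberwise (Finset.univ : Finset (Fin r → V)) (fun k => k 0)]
  refine Finset.sum_le_sum fun i _ => ?_
  have h : ‖l‖ * ‖x i‖ ^ r = ‖x i‖ * ‖(G.cliqueTensor r).apply x i‖ := by
    rw [hx, norm_mul, norm_pow, mul_left_comm, ← pow_succ',
      Nat.sub_add_cancel (Nat.one_le_iff_ne_zero.2 (NeZero.ne r))]
  rw [h]
  unfold HypTensor.apply
  refine (mul_le_mul_of_nonneg_left (norm_sum_le _ _) (norm_nonneg _)).trans ?_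
  rw [Finset.mul_sum]
  refine le_of_eq (Finset.sum_congr (by congr!) fun k hk => ?_)
  rw [← norm_cliqueTensor_mul_prod]
  have hk0 : k 0 = i := (Finset.mem_filter.1 hk).2
  rw [← Finset.mul_prod_erase _ _ (Finset.mem_univ (0 : Fin r)), hk0, norm_mul, norm_prod,
    mul_left_comm]
  congr! 3
  ext j
  simp

lemma cliqueWeight_const_mul {V : Type*} [Fintype V] (G : SimpleGraph V) (c : ℝ) (y : V → ℝ)
    (r : ℕ) : G.cliqueWeight (fun i => c * y i) r = c ^ r * G.cliqueWeight y r := by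
  unfold cliqueWeight
  rw [Finset.mul_sum]
  refine Finset.sum_congr rfl fun k _ => ?_
  unfold tupleWeight
  split_ifs
  · rw [Finset.prod_mul_distrib]; simp
  · simp

lemma exists_weight_of_isEigenvalue {V : Type*} [Fintype V] (G : SimpleGraph V) {r : ℕ} [NeZero r]
    {l : ℂ} (hl : (G.cliqueTensor r).IsEigenvalue l) {B : ℝ} (hB : 0 < B) :
    ∃ w : V → ℝ, (∀ v, 0 ≤ w v) ∧ ∑ v, w v ^ r = B ∧
      ‖l‖ * B ≤ G.cliqueWeight w r / (r - 1)! := by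
  obtain ⟨x, hx0, hx⟩ := hl
  obtain ⟨v, hv⟩ := Function.ne_iff.1 hx0
  have hpos : 0 < ∑ i, ‖x i‖ ^ r :=
    Finset.sum_pos' (fun i _ => by positivity) ⟨v, Finset.mem_univ v, by
      have : 0 < ‖x v‖ := norm_pos_iff.2 hv
      positivity⟩
  set B₀ := ∑ i, ‖x i‖ ^ r with hB₀
  set c : ℝ := (B / B₀) ^ ((r : ℝ)⁻¹) with hc
  have hcr : c ^ r = B / B₀ := Real.rpow_inv_natCast_pow (by positivity) (NeZero.ne r)
  refine ⟨fun i => c * ‖x i‖, fun i => by positivity, ?_, ?_⟩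
  · simp_rw [mul_pow]
    rw [← Finset.mul_sum, hcr, ← hB₀, div_mul_cancel₀ _ hpos.ne']
  · have h := norm_eigenvalue_mul_sum_le G hx
    rw [cliqueWeight_const_mul, hcr]
    calc ‖l‖ * B = (B / B₀) * (‖l‖ * B₀) := by field_simp
      _ ≤ (B / B₀) * (G.cliqueWeight (fun i => ‖x i‖) r / (r - 1)!) := by gcongr
      _ = _ := by ring

/-- The power mean inequality over clique tuples, after which the sum of powers is enlarged to all
tuples, where it factorizes. -/
lemma cliqueWeight_pow_le {V : Type*} [Fintype V] (G : SimpleGraph V) {w : V → ℝ}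
    (hw : ∀ v, 0 ≤ w v) (p s : ℕ) :
    G.cliqueWeight w s ^ (p + 1) ≤
      relCount (G.IsCliqueTuple (s := s)) ^ p * (∑ v, w v ^ (p + 1)) ^ s := by
  classical
  unfold cliqueWeight relCount tupleWeight
  rw [← Finset.sum_filter, Finset.sum_boole, Fintype.sum_pow]
  have hw' : ∀ k : Fin s → V, 0 ≤ ∏ j, w (k j) := fun k => Finset.prod_nonneg fun j _ => hw _
  calc _ ≤ _ := pow_sum_le_card_mul_sum_pow (fun k _ => hw' k) p
    _ ≤ _ := by
      gcongr
      simp_rw [← Finset.prod_pow]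
      refine Finset.sum_le_sum_of_subset_of_nonneg (Finset.subset_univ _) fun k _ _ => ?_
      exact Finset.prod_nonneg fun j _ => pow_nonneg (hw _) _

lemma eventually_norm_eigenvalue_le {W : Type*} [Finite W] {H : SimpleGraph W} {r : ℕ} [NeZero r]
    (hr : 2 ≤ r) (C : H.Coloring (Fin (r + 1))) {ε : ℝ} (hε : 0 < ε) :
    ∀ᶠ n : ℕ in atTop, ∀ G : SimpleGraph (Fin n), H.Free G → ∀ l : ℂ,
      (G.cliqueTensor r).IsEigenvalue l →
      ‖l‖ ≤ (1 / (r : ℝ) ^ (r - 1) + ε) * n ^ (r - 1) := by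
  -- The factor (r-1)! cancels the denominator coming from the tensor entries.
  obtain ⟨η, hη, hmm⟩ := exists_cliqueWeight_le r (ε := ε * (r - 1)!) (by positivity)
  obtain ⟨p, rfl⟩ : ∃ p, r = p + 1 := ⟨r - 1, by omega⟩
  rw [Nat.add_sub_cancel] at *
  set θ := min η 1
  have hθ : 0 < θ := lt_min hη one_pos
  filter_upwards [eventually_relCount_isCliqueTuple_le C (pow_pos hθ (p + 1)),
    eventually_ge_atTop 1] with n hn h1 G hG l hl
  have hn0 : (0 : ℝ) < n := by exact_mod_cast h1
  -- This normalization makes ∑ w ≤ 1 and cancels the power of n in the clique count.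
  obtain ⟨w, hw, hB, hle⟩ := exists_weight_of_isEigenvalue G hl
    (B := ((n : ℝ) ^ p)⁻¹) (by positivity)
  have hS : ∑ v, w v ≤ 1 := by
    refine le_of_pow_le_pow_left₀ (n := p + 1) (by omega) zero_le_one ?_
    have := pow_sum_le_card_mul_sum_pow (s := Finset.univ) (f := w) (fun k _ => hw k) p
    rw [hB, Finset.card_univ, Fintype.card_fin, mul_inv_cancel₀ (by positivity)] at this
    simpa using this
  have hT : G.cliqueWeight w (p + 1 + 1) ≤ η := by
    refine le_trans ?_ (min_le_left η 1)
    change _ ≤ θ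
    refine le_of_pow_le_pow_left₀ (n := p + 1) (by omega) hθ.le ?_
    refine (cliqueWeight_pow_le G hw p _).trans ?_
    rw [hB]
    have hR : 0 ≤ relCount (G.IsCliqueTuple (s := p + 1 + 1)) := relCount_nonneg _
    calc _ ≤ (θ ^ (p + 1) * n ^ (p + 1 + 1)) ^ p * ((n ^ p : ℝ)⁻¹) ^ (p + 1 + 1) := by
          gcongr
          exact hn G hG
      _ = (θ ^ (p + 1)) ^ p := by
          rw [mul_pow, mul_assoc, ← pow_mul, inv_pow, ← pow_mul, ← pow_mul, mul_comm p (p + 1 + 1),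
            mul_inv_cancel₀ (by positivity), mul_one]
      -- Needs θ ≤ 1 and p ≥ 1; hence the cap in θ and the separate treatment of r = 1.
      _ ≤ (θ ^ (p + 1)) ^ 1 := pow_le_pow_of_le_one (by positivity)
          (pow_le_one₀ hθ.le (min_le_right _ _)) (by omega)
      _ = θ ^ (p + 1) := pow_one _
  have hTr := hmm G w hw hS hT
  have hf : (0 : ℝ) < p ! := by positivity
  have h2 : ‖l‖ * ((n : ℝ) ^ p)⁻¹ ≤ 1 / ((p + 1 : ℕ) : ℝ) ^ p + ε := by
    refine hle.trans ?_
    rw [Nat.add_sub_cancel, div_le_iff₀ hf]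
    refine hTr.trans (le_of_eq ?_)
    rw [Nat.factorial_succ, pow_succ]
    push_cast
    field_simp
  rwa [← div_eq_mul_inv, div_le_iff₀ (by positivity)] at h2

end SimpleGraph

/-! ### Existence of the spectral radius and of the extremal value. -/

namespace HypTensor

variable {V : Type*} [Fintype V] {m : ℕ} [NeZero m]

lemma apply_smul (A : HypTensor V m) (c : ℂ) (x : V → ℂ) (i : V) :
    A.apply (c • x) i = c ^ (m - 1) * A.apply x i := by
  unfold apply
  rw [Finset.mul_sum]
  refine Finset.sum_congr rfl fun k _ => ?_
  have : (Finset.univ.filter fun j : Fin m => j ≠ 0).card = m - 1 := by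
    rw [Finset.filter_ne', Finset.card_erase_of_mem (Finset.mem_univ _)]
    simp
  simp only [Pi.smul_apply, smul_eq_mul, Finset.prod_mul_distrib, Finset.prod_const, this]
  ring

lemma continuous_apply (A : HypTensor V m) (i : V) : Continuous fun x => A.apply x i := by
  unfold apply
  fun_prop

lemma norm_apply_le (A : HypTensor V m) {x : V → ℂ} (hx : ‖x‖ ≤ 1) (i : V) :
    ‖A.apply x i‖ ≤ ∑ k, ‖A k‖ := by
  classical
  unfold apply
  refine (norm_sum_le _ _).trans ((Finset.sum_le_sum fun k _ => ?_).trans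
    (Finset.sum_le_sum_of_subset_of_nonneg (Finset.subset_univ _) fun _ _ _ => norm_nonneg _))
  rw [norm_mul, norm_prod]
  exact mul_le_of_le_one_right (norm_nonneg _)
    (Finset.prod_le_one (fun _ _ => norm_nonneg _) fun j _ => (norm_le_pi_norm x _).trans hx)

lemma IsEigenvalue.exists_norm_eq_one {A : HypTensor V m} {l : ℂ} (hl : A.IsEigenvalue l) :
    ∃ x : V → ℂ, ‖x‖ = 1 ∧ ∀ i, A.apply x i = l * x i ^ (m - 1) := by
  obtain ⟨x, hx, h⟩ := hl
  refine ⟨((‖x‖⁻¹ : ℝ) : ℂ) • x, ?_, fun i => ?_⟩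
  · rw [norm_smul, Complex.norm_real, norm_inv, norm_norm,
      inv_mul_cancel₀ (norm_ne_zero_iff.2 hx)]
  · rw [apply_smul, h, Pi.smul_apply, smul_eq_mul, mul_pow]
    ring

lemma norm_le_of_apply_eq {A : HypTensor V m} {l : ℂ} {x : V → ℂ} (hx : ‖x‖ = 1)
    (h : ∀ i, A.apply x i = l * x i ^ (m - 1)) : ‖l‖ ≤ ∑ k, ‖A k‖ := by
  obtain ⟨i, hi⟩ : ∃ i, 1 ≤ ‖x i‖ := by
    by_contra! hlt
    exact hx.not_lt ((pi_norm_lt_iff one_pos).2 hlt)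
  calc ‖l‖ ≤ ‖l‖ * ‖x i‖ ^ (m - 1) := le_mul_of_one_le_right (norm_nonneg _) (one_le_pow₀ hi)
    _ = ‖A.apply x i‖ := by rw [h, norm_mul, norm_pow]
    _ ≤ _ := norm_apply_le A hx.le i

/-- By homogeneity eigenvectors may be taken on the unit sphere; the eigenpairs there form a closed
bounded set, and this is its image under (λ, x) ↦ |λ|. -/
lemma isCompact_eigenvalueModuli (A : HypTensor V m) : IsCompact A.eigenvalueModuli := by
  have hK : IsCompact ((Metric.closedBall (0 : ℂ) (∑ k, ‖A k‖) ×ˢ Metric.sphere (0 : V → ℂ) 1) ∩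
      {p | ∀ i, A.apply p.2 i = p.1 * p.2 i ^ (m - 1)}) := by
    refine ((isCompact_closedBall _ _).prod (isCompact_sphere _ _)).inter_right ?_
    simp only [Set.ofPred_forall]
    refine isClosed_iInter fun i => isClosed_eq ((A.continuous_apply i).comp continuous_snd) ?_
    fun_prop
  convert hK.image (f := fun p : ℂ × (V → ℂ) => ‖p.1‖) (by fun_prop)
  ext ρ
  constructor
  · rintro ⟨l, hl, rfl⟩
    obtain ⟨x, hx, h⟩ := hl.exists_norm_eq_one
    exact ⟨(l, x), ⟨⟨by simpa using norm_le_of_apply_eq hx h, by simpa using hx⟩, h⟩, rfl⟩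
  · rintro ⟨⟨l, x⟩, ⟨⟨-, hx⟩, h⟩, rfl⟩
    refine ⟨l, ⟨x, ?_, h⟩, rfl⟩
    rintro rfl
    simp at hx

lemma isGreatest_spectralRadius {A : HypTensor V m} (h : ∃ l, A.IsEigenvalue l) :
    IsGreatest A.eigenvalueModuli A.spectralRadius :=
  A.isCompact_eigenvalueModuli.isGreatest_sSup (let ⟨l, hl⟩ := h; ⟨‖l‖, l, hl, rfl⟩)

lemma apply_of_order_two (A : HypTensor V 2) (x : V → ℂ) (i : V) [DecidableEq V] :
    A.apply x i = ∑ k : Fin 2 → V with k 0 = i, A k * x (k 1) := by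
  unfold apply
  have : (Finset.univ.filter fun j : Fin 2 => j ≠ 0) = {1} := by decide
  simp_rw [this, Finset.prod_singleton]
  congr!

/-- In order two the eigenvalue problem is linear, over an algebraically closed field. -/
lemma exists_isEigenvalue_of_order_two [Nonempty V] (A : HypTensor V 2) :
    ∃ l, A.IsEigenvalue l := by
  classical
  let L : Module.End ℂ (V → ℂ) :=
    { toFun := fun x i => A.apply x i
      map_add' := fun x y => by
        ext i
        simp only [apply_of_order_two, Pi.add_apply, mul_add, Finset.sum_add_distrib]
      map_smul' := fun c x => by
        ext i
        simp [apply_smul] }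
  obtain ⟨l, hl⟩ := Module.End.exists_eigenvalue L
  obtain ⟨x, hx⟩ := hl.exists_hasEigenvector
  refine ⟨l, x, hx.2, fun i => ?_⟩
  have := congrFun hx.apply_eq_smul i
  simpa [L] using this

end HypTensor

namespace SimpleGraph

lemma isCliqueTuple_of_subsingleton {V : Type*} (G : SimpleGraph V) {s : ℕ} [Subsingleton (Fin s)]
    (k : Fin s → V) : G.IsCliqueTuple k :=
  fun _ _ h => absurd (Subsingleton.elim _ _) h

lemma cliqueTensor_one_apply {V : Type*} [Fintype V] (G : SimpleGraph V) (x : V → ℂ) (i : V) :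
    (G.cliqueTensor 1).apply x i = 1 := by
  classical
  unfold HypTensor.apply
  rw [Finset.sum_eq_single_of_mem (fun _ => i) (by simp)]
  · rw [cliqueTensor_apply, if_pos (isCliqueTuple_of_subsingleton G _), Finset.prod_eq_one]
    · simp
    · intro j hj
      exact absurd (Subsingleton.elim j 0) (Finset.mem_filter.1 hj).2
  · intro k hk hne
    refine absurd (funext fun j => ?_) hne
    rw [Subsingleton.elim j 0]
    exact (Finset.mem_filter.1 hk).2

lemma isEigenvalue_cliqueTensor_one {V : Type*} [Fintype V] [Nonempty V] (G : SimpleGraph V) :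
    (G.cliqueTensor 1).IsEigenvalue 1 :=
  ⟨1, one_ne_zero, fun i => by rw [cliqueTensor_one_apply]; simp⟩

/-- A standard basis vector is an eigenvector: a nonzero term would need two distinct clique
entries, both equal to v. -/
lemma isEigenvalue_cliqueTensor_zero {V : Type*} [Fintype V] [Nonempty V] (G : SimpleGraph V)
    {r : ℕ} [NeZero r] (hr : 3 ≤ r) : (G.cliqueTensor r).IsEigenvalue 0 := by
  classical
  obtain ⟨v⟩ := ‹Nonempty V›
  refine ⟨Pi.single v 1, by simp, fun i => ?_⟩
  rw [zero_mul]
  refine Finset.sum_eq_zero fun k _ => ?_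
  rw [cliqueTensor_apply]
  split_ifs with h
  swap
  · simp
  obtain ⟨p, rfl⟩ : ∃ p, r = p + 3 := ⟨r - 3, by omega⟩
  have h12 : (⟨1, by omega⟩ : Fin (p + 3)) ≠ ⟨2, by omega⟩ := by simp
  have hz : ∃ j : Fin (p + 3), j ≠ 0 ∧ k j ≠ v := by
    by_cases h1 : k ⟨1, by omega⟩ = v
    · exact ⟨⟨2, by omega⟩, by simp [Fin.ext_iff], fun h2 => (h h12).ne (h1.trans h2.symm)⟩
    · exact ⟨⟨1, by omega⟩, by simp, h1⟩
  obtain ⟨j, hj0, hjv⟩ := hz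
  rw [Finset.prod_eq_zero (i := j) (by simpa using hj0) (by simp [hjv]), mul_zero]

lemma exists_isEigenvalue_cliqueTensor {V : Type*} [Fintype V] [Nonempty V] (G : SimpleGraph V)
    (r : ℕ) [h : NeZero r] : ∃ l, (G.cliqueTensor r).IsEigenvalue l := by
  match r, h with
  | 0, h => exact absurd rfl h.out
  | 1, _ => exact ⟨1, isEigenvalue_cliqueTensor_one G⟩
  | 2, _ => exact (G.cliqueTensor 2).exists_isEigenvalue_of_order_two
  | r + 3, _ => exact ⟨0, isEigenvalue_cliqueTensor_zero G (by omega)⟩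

lemma isGreatest_cliqueSpectralRadius {V : Type*} [Fintype V] [Nonempty V] (G : SimpleGraph V)
    (r : ℕ) [NeZero r] :
    IsGreatest (G.cliqueTensor r).eigenvalueModuli (G.cliqueSpectralRadius r) :=
  HypTensor.isGreatest_spectralRadius (exists_isEigenvalue_cliqueTensor G r)

lemma finite_freeCliqueSpectralRadii {W : Type*} (H : SimpleGraph W) (r : ℕ) [NeZero r] (n : ℕ) :
    (H.freeCliqueSpectralRadii r n).Finite := by
  refine (Set.finite_range fun G : SimpleGraph (Fin n) => G.cliqueSpectralRadius r).subset ?_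
  rintro ρ ⟨G, -, rfl⟩
  exact ⟨G, rfl⟩

lemma isGreatest_exCliqueSpectralRadius {W : Type*} {H : SimpleGraph W} {r : ℕ} [NeZero r] {n : ℕ}
    {G : SimpleGraph (Fin n)} (hG : H.Free G) :
    IsGreatest (H.freeCliqueSpectralRadii r n) (H.exCliqueSpectralRadius r n) :=
  (finite_freeCliqueSpectralRadii H r n).isCompact.isGreatest_sSup ⟨_, G, hG, rfl⟩

/-! ### The balanced complete multipartite graph and the lower bound. -/

lemma mem_range_of_isCliqueTuple_map {V U : Type*} {K : SimpleGraph U} (f : U ↪ V) {s : ℕ}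
    [Nontrivial (Fin s)] {k : Fin s → V} (hk : (K.map f).IsCliqueTuple k) (j : Fin s) :
    k j ∈ Set.range f := by
  obtain ⟨i, hi⟩ := exists_ne j
  obtain ⟨a, b, -, ha, -⟩ := (map_adj _ _ _ _).1 (hk hi.symm)
  exact ⟨a, ha⟩

/-- The ordered cliques through a fixed first vertex in a copy of the complete equipartite graph
on `p + 1` parts of size `q`. -/
lemma card_isCliqueTuple_map_completeEquipartiteGraph {V : Type*} [Fintype V] [DecidableEq V]
    {p q : ℕ} (hp : 1 ≤ p) (f : Fin (p + 1) × Fin q ↪ V) (u : Fin (p + 1) × Fin q)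
    [DecidablePred fun k : Fin (p + 1) → V =>
      k 0 = f u ∧ ((completeEquipartiteGraph (p + 1) q).map f).IsCliqueTuple k] :
    (Finset.univ.filter fun k : Fin (p + 1) → V =>
      k 0 = f u ∧ ((completeEquipartiteGraph (p + 1) q).map f).IsCliqueTuple k).card =
      p ! * q ^ p := by
  have hcard : (Finset.univ : Finset (Equiv.Perm (Fin p) × (Fin p → Fin q))).card =
      p ! * q ^ p := by
    rw [Finset.card_univ, Fintype.card_prod, Fintype.card_perm]
    simp
  rw [← hcard]
  symm
  -- An ordered clique meets each part once: it is a permutation of the parts sending 0 to the part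
  -- of u, together with a vertex choice in each later part. `Equiv.Perm.decomposeFin` separates the
  -- image of 0 from the rest.
  refine Finset.card_bij
    (fun et _ j => f (Equiv.Perm.decomposeFin.symm (u.1, et.1) j,
      (Fin.cons u.2 et.2 : Fin (p + 1) → Fin q) j)) ?_ ?_ ?_
  · intro et _
    rw [Finset.mem_filter]
    refine ⟨Finset.mem_univ _, ?_, fun i j hij => ?_⟩
    · simp
    · beta_reduce
      rw [map_adj_apply, completeEquipartiteGraph_adj]
      exact (Equiv.injective _).ne hij
  · rintro ⟨e, t⟩ _ ⟨e', t'⟩ _ h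
    have h' := fun j => Prod.mk.inj (f.injective (congrFun h j))
    have h1 : e = e' := by
      have := Equiv.ext fun j => (h' j).1
      exact (Prod.mk.inj (Equiv.Perm.decomposeFin.symm.injective this)).2
    have h2 : t = t' := funext fun j => by simpa using (h' j.succ).2
    rw [h1, h2]
  · intro k hk
    obtain ⟨-, hk0, hk⟩ := Finset.mem_filter.1 hk
    have : Nontrivial (Fin (p + 1)) := Fin.nontrivial_iff_two_le.2 (by omega)
    have hrange : ∀ j, ∃ v, f v = k j := mem_range_of_isCliqueTuple_map f hk
    choose v hv using hrange
    have hinj : Function.Injective fun j => (v j).1 := by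
      intro i j hij
      by_contra hne
      have : (SimpleGraph.map f _).Adj (k i) (k j) := hk hne
      rw [← hv, ← hv, map_adj_apply, completeEquipartiteGraph_adj] at this
      exact this hij
    have hv0 : v 0 = u := f.injective ((hv 0).trans hk0)
    let σ : Equiv.Perm (Fin (p + 1)) := Equiv.ofBijective _ (Finite.injective_iff_bijective.1 hinj)
    have hσ0 : (Equiv.Perm.decomposeFin σ).1 = u.1 := by
      have h := Equiv.Perm.decomposeFin_symm_apply_zero (Equiv.Perm.decomposeFin σ).1
        (Equiv.Perm.decomposeFin σ).2
      rw [Prod.mk.eta, Equiv.symm_apply_apply] at h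
      rw [← h, ← hv0]
      rfl
    refine ⟨((Equiv.Perm.decomposeFin σ).2, fun j => (v j.succ).2), Finset.mem_univ _, ?_⟩
    funext j
    rw [← hv j]
    congr 1
    refine Prod.ext ?_ ?_
    · change Equiv.Perm.decomposeFin.symm (u.1, (Equiv.Perm.decomposeFin σ).2) j = σ j
      rw [← hσ0, Prod.mk.eta, Equiv.symm_apply_apply]
    · refine Fin.cases ?_ (fun j => ?_) j
      · simp [hv0]
      · simp

/-- The eigenvector is the indicator of the copy: each of its vertices starts p! q^p ordered
cliques, each with entry 1/p!. -/
lemma isEigenvalue_map_completeEquipartiteGraph {V : Type*} [Fintype V] {p q : ℕ} (hp : 1 ≤ p)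
    (hq : 1 ≤ q) (f : Fin (p + 1) × Fin q ↪ V) :
    (((completeEquipartiteGraph (p + 1) q).map f).cliqueTensor (p + 1)).IsEigenvalue (q ^ p) := by
  classical
  set G := (completeEquipartiteGraph (p + 1) q).map f with hG
  have : Nontrivial (Fin (p + 1)) := Fin.nontrivial_iff_two_le.2 (by omega)
  have hrange : ∀ {k : Fin (p + 1) → V}, G.IsCliqueTuple k → ∀ j, k j ∈ Set.range f :=
    mem_range_of_isCliqueTuple_map f
  let x : V → ℂ := fun v => if v ∈ Set.range f then 1 else 0
  have happ : ∀ i, (G.cliqueTensor (p + 1)).apply x i =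
      (Finset.univ.filter fun k : Fin (p + 1) → V => k 0 = i ∧ G.IsCliqueTuple k).card / p ! := by
    intro i
    unfold HypTensor.apply
    rw [← Finset.filter_filter, Finset.card_filter, Nat.cast_sum, Finset.sum_div]
    refine Finset.sum_congr (by congr!) fun k _ => ?_
    rw [cliqueTensor_apply]
    split_ifs with hk
    · rw [Finset.prod_eq_one fun j _ => if_pos (hrange hk j)]
      simp
    · simp
  have h0 : f (0, ⟨0, hq⟩) ∈ Set.range f := ⟨_, rfl⟩
  refine ⟨x, fun hx => ?_, fun i => ?_⟩
  · have := congrFun hx (f (0, ⟨0, hq⟩))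
    simp only [x, if_pos h0, Pi.zero_apply] at this
    exact one_ne_zero this
  · rw [happ, Nat.add_sub_cancel]
    by_cases hi : i ∈ Set.range f
    · obtain ⟨u, rfl⟩ := hi
      rw [hG, card_isCliqueTuple_map_completeEquipartiteGraph hp]
      have : ((p ! : ℕ) : ℂ) ≠ 0 := by exact_mod_cast p.factorial_ne_zero
      simp only [x, Set.mem_range_self, if_true]
      push_cast
      field_simp
      simp
    · rw [Finset.card_eq_zero.2, show x i = 0 from if_neg hi, zero_pow (by omega)]
      · simp
      · refine Finset.filter_eq_empty_iff.2 fun k _ hk => hi ?_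
        rw [← hk.1]
        exact hrange hk.2 0

lemma norm_eigenvalue_le_one_of_order_one {V : Type*} [Fintype V] (G : SimpleGraph V) {l : ℂ}
    (hl : (G.cliqueTensor 1).IsEigenvalue l) : ‖l‖ ≤ 1 := by
  obtain ⟨x, hx0, hx⟩ := hl
  obtain ⟨i, -⟩ := Function.ne_iff.1 hx0
  have := hx i
  rw [cliqueTensor_one_apply] at this
  simp only [Nat.sub_self, pow_zero, mul_one] at this
  simp [← this]

lemma eventually_norm_eigenvalue_cliqueTensor_le {W : Type*} [Finite W] {H : SimpleGraph W} {r : ℕ}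
    [h : NeZero r] (C : H.Coloring (Fin (r + 1))) {ε : ℝ} (hε : 0 < ε) :
    ∀ᶠ n : ℕ in atTop, ∀ G : SimpleGraph (Fin n), H.Free G → ∀ l : ℂ,
      (G.cliqueTensor r).IsEigenvalue l →
      ‖l‖ ≤ (1 / (r : ℝ) ^ (r - 1) + ε) * n ^ (r - 1) := by
  match r, h with
  | 0, h => exact absurd rfl h.out
  | 1, _ =>
    refine Eventually.of_forall fun n G _ l hl => ?_
    have := norm_eigenvalue_le_one_of_order_one G hl
    simp
    linarith
  | r + 2, _ => exact eventually_norm_eigenvalue_le (by omega) C hε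

lemma exists_colorable_le_cliqueSpectralRadius (r : ℕ) [h : NeZero r] {n : ℕ} (hn : 1 ≤ n) :
    ∃ G : SimpleGraph (Fin n), G.Colorable r ∧
      ((n / r : ℕ) : ℝ) ^ (r - 1) ≤ G.cliqueSpectralRadius r := by
  have : Nonempty (Fin n) := ⟨⟨0, hn⟩⟩
  have hbot : (⊥ : SimpleGraph (Fin n)).Colorable r :=
    ⟨Coloring.mk (fun _ => 0) fun h => absurd h (by simp)⟩
  match r, h with
  | 0, h => exact absurd rfl h.out
  | 1, _ =>
    refine ⟨⊥, hbot, (isGreatest_cliqueSpectralRadius _ 1).2 ?_⟩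
    exact ⟨1, isEigenvalue_cliqueTensor_one _, by simp⟩
  | p + 2, _ =>
    -- With empty parts the indicator vector would vanish, but the claimed bound is then 0.
    rcases Nat.eq_zero_or_pos (n / (p + 2)) with hq | hq
    · refine ⟨⊥, hbot, ?_⟩
      obtain ⟨l, -, hl⟩ := (isGreatest_cliqueSpectralRadius (⊥ : SimpleGraph (Fin n)) (p + 2)).1
      rw [hq, hl]
      simp
    · have hle : Fintype.card (Fin (p + 2) × Fin (n / (p + 2))) ≤ Fintype.card (Fin n) := by
        simpa using Nat.mul_div_le n (p + 2)
      obtain ⟨f⟩ := Function.Embedding.nonempty_of_card_le hle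
      refine ⟨(completeEquipartiteGraph (p + 2) (n / (p + 2))).map f, ?_,
        (isGreatest_cliqueSpectralRadius _ (p + 2)).2 ?_⟩
      · exact Colorable.map f ⟨Coloring.mk Prod.fst fun h => h⟩
      · exact ⟨_, isEigenvalue_map_completeEquipartiteGraph (by omega) hq f, by simp⟩

lemma one_div_sub_one_div_le_natDiv_div {n r : ℕ} (hn : 1 ≤ n) (hr : 1 ≤ r) :
    (1 / r - 1 / n : ℝ) ≤ ((n / r : ℕ) : ℝ) / n := by
  have hn0 : (0 : ℝ) < n := by exact_mod_cast hn
  have hr0 : (0 : ℝ) < r := by exact_mod_cast hr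
  have h : (n : ℝ) < r * ((n / r : ℕ) + 1) := by exact_mod_cast Nat.lt_mul_div_succ n hr
  rw [le_div_iff₀ hn0, sub_mul, one_div_mul_cancel hn0.ne', sub_le_iff_le_add, one_div,
    inv_mul_le_iff₀ hr0]
  exact h.le

end SimpleGraph

open SimpleGraph in
theorem theorem3 {W : Type*} [Finite W] (H : SimpleGraph W) (r : ℕ) [NeZero r]
    (hH : H.chromaticNumber = ((r + 1 : ℕ) : ℕ∞)) :
    -- the maxima that define the spectral radius and the extremal function are attained
    (∀ n : ℕ, 1 ≤ n → ∀ G : SimpleGraph (Fin n),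
      IsGreatest (G.cliqueTensor r).eigenvalueModuli (G.cliqueSpectralRadius r)) ∧
    (∀ n : ℕ, 1 ≤ n →
      IsGreatest (H.freeCliqueSpectralRadii r n) (H.exCliqueSpectralRadius r n)) ∧
    -- the asymptotic formula
    ∃ ε : ℕ → ℝ, Tendsto ε atTop (𝓝 0) ∧
      ∀ n : ℕ, 1 ≤ n →
        H.exCliqueSpectralRadius r n = (1 / (r : ℝ) ^ (r - 1) + ε n) * (n : ℝ) ^ (r - 1) := by
  have hr : 1 ≤ r := Nat.one_le_iff_ne_zero.2 (NeZero.ne r)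
  obtain ⟨C⟩ : H.Colorable (r + 1) := chromaticNumber_le_iff_colorable.1 hH.le
  have hnc : ¬ H.Colorable r := fun h => by
    have := hH.symm.le.trans (chromaticNumber_le_iff_colorable.2 h)
    rw [Nat.cast_le] at this
    omega
  have hrad : ∀ n : ℕ, 1 ≤ n → ∀ G : SimpleGraph (Fin n),
      IsGreatest (G.cliqueTensor r).eigenvalueModuli (G.cliqueSpectralRadius r) := fun n hn G =>
    have : Nonempty (Fin n) := ⟨⟨0, hn⟩⟩
    isGreatest_cliqueSpectralRadius G r
  have hex : ∀ n : ℕ, 1 ≤ n →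
      IsGreatest (H.freeCliqueSpectralRadii r n) (H.exCliqueSpectralRadius r n) := fun n hn =>
    let ⟨_, hG, _⟩ := exists_colorable_le_cliqueSpectralRadius r hn
    isGreatest_exCliqueSpectralRadius (free_of_colorable hnc hG)
  -- The error is defined so that the formula is exact; only its convergence remains.
  refine ⟨hrad, hex, fun n => H.exCliqueSpectralRadius r n / n ^ (r - 1) - 1 / r ^ (r - 1), ?_, ?_⟩
  swap
  · intro n hn
    have hn0 : (0 : ℝ) < n := by exact_mod_cast hn
    rw [add_sub_cancel, div_mul_cancel₀ _ (by positivity)]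
  have hr0 : (0 : ℝ) < r := by exact_mod_cast hr
  have hlim : Tendsto (fun n : ℕ => (1 / r - 1 / n : ℝ) ^ (r - 1) - 1 / (r : ℝ) ^ (r - 1))
      atTop (𝓝 0) := by
    have := ((tendsto_const_nhds (x := (1 / r : ℝ))).sub
      (tendsto_const_div_atTop_nhds_zero_nat (1 : ℝ))).pow (r - 1)
    simpa using this.sub_const (1 / (r : ℝ) ^ (r - 1))
  have hlower : ∀ᶠ n : ℕ in atTop, (1 / r - 1 / n : ℝ) ^ (r - 1) - 1 / (r : ℝ) ^ (r - 1) ≤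
      H.exCliqueSpectralRadius r n / n ^ (r - 1) - 1 / r ^ (r - 1) := by
    -- n ≥ r makes 1/r - 1/n nonnegative, as taking powers requires.
    filter_upwards [eventually_ge_atTop r] with n hn
    have hn0 : (0 : ℝ) < n := by exact_mod_cast hr.trans hn
    obtain ⟨G, hG, hle⟩ := exists_colorable_le_cliqueSpectralRadius r (hr.trans hn)
    have h1 := (hex n (hr.trans hn)).2 ⟨G, free_of_colorable hnc hG, rfl⟩
    have h2 : (0 : ℝ) ≤ 1 / r - 1 / n :=
      sub_nonneg.2 (one_div_le_one_div_of_le hr0 (by exact_mod_cast hn))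
    gcongr
    calc _ ≤ (((n / r : ℕ) : ℝ) / n) ^ (r - 1) :=
          pow_le_pow_left₀ h2 (one_div_sub_one_div_le_natDiv_div (hr.trans hn) hr) _
      _ = ((n / r : ℕ) : ℝ) ^ (r - 1) / n ^ (r - 1) := div_pow _ _ _
      _ ≤ _ := by
        gcongr
        exact hle.trans h1
  rw [tendsto_order]
  refine ⟨fun a ha => ?_, fun a ha => ?_⟩
  · filter_upwards [hlim.eventually (lt_mem_nhds ha), hlower] with n h1 h2
    exact h1.trans_le h2
  · filter_upwards [eventually_norm_eigenvalue_cliqueTensor_le C (half_pos ha),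
      eventually_ge_atTop 1] with n hn h1
    have hn0 : (0 : ℝ) < n := by exact_mod_cast h1
    obtain ⟨G, hG, hGe⟩ := (hex n h1).1
    obtain ⟨l, hl, hle⟩ := (hrad n h1 G).1
    have := hn G hG l hl
    rw [← hle, ← hGe, ← div_le_iff₀ (by positivity)] at this
    linarith
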